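/- Consider three point particles of equal mass $M>0$ in the Euclidean plane, with configuration space $E=(\mathbb{R}^2)^3$ carrying the mass metric $\langle v,w\rangle=M\sum_{i=1}^3\langle v_i,w_i\rangle$, and let $\Delta_{ij}=\{q\in E: q_i=q_j\}$ for $1\le i\neq j\le 3$ be the binary collision subspaces. A billiard trajectory is a polygonal curve $\ell:\mathbb{R}\to E$, with constant velocity on each edge, such that: every vertex lies in $\bigcup_{i\ne j}\Delta_{ij}$; the collision points, that is, the times $t$ with $\ell(t)\in\bigcup_{i\neq j}\Delta_{ij}$, are discrete; no edge lies within a collision subspace; and at each collision point $t$ there are $i\neq j$ with $\ell(t)\in\Delta_{ij}$ such that the velocities $v_-$ and $v_+$ immediately before and after $t$ satisfy $$\|v_-\|=\|v_+\|,\qquad \pi_{\Delta_{ij}}(v_-)=\pi_{\Delta_{ij}}(v_+),$$ where $\pi_{\Delta_{ij}}$ is the orthogonal projection onto $\Delta_{ij}$ (norm and projection are those of the mass metric). Then every billiard trajectory has at most $3$ collision points. -/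

import Mathlib

open scoped Topology

namespace PointBilliard

/-- The configuration space `E = (ℝ^d)^N` of `N` point particles in Euclidean `d`-space. -/
abbrev Config (N d : ℕ) : Type := Fin N → EuclideanSpace ℝ (Fin d)

/-- The mass metric `⟨v, w⟩ = ∑ i, m i * ⟨v i, w i⟩` on the configuration space. -/
noncomputable def massInner {N d : ℕ} (m : Fin N → ℝ) (v w : Config N d) : ℝ :=
  ∑ i, m i * inner ℝ (v i) (w i)

/-- The norm of the mass metric. -/
noncomputable def massNorm {N d : ℕ} (m : Fin N → ℝ) (v : Config N d) : ℝ :=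
  Real.sqrt (massInner m v v)

/-- `p` is the orthogonal projection of `v` onto the subspace `U`, for the mass metric. -/
def IsMassProj {N d : ℕ} (m : Fin N → ℝ) (U : Submodule ℝ (Config N d)) (v p : Config N d) :
    Prop :=
  p ∈ U ∧ ∀ u ∈ U, massInner m (v - p) u = 0

/-- The binary collision subspace `Δ i j = {q | q i = q j}`. -/
def collisionSubspace {N d : ℕ} (i j : Fin N) : Submodule ℝ (Config N d) where
  carrier := {q | q i = q j}
  add_mem' := fun {a b} ha hb => by
    show a i + b i = a j + b j
    rw [show a i = a j from ha, show b i = b j from hb]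
  zero_mem' := rfl
  smul_mem' := fun c a ha => by
    show c • a i = c • a j
    rw [show a i = a j from ha]

/-- The collision locus, the union of all `Δ i j` with `i ≠ j`. -/
def collisionLocus (N d : ℕ) : Set (Config N d) :=
  {q | ∃ i j : Fin N, i ≠ j ∧ q ∈ collisionSubspace i j}

/-- The collision points of a curve: the times at which it lies in some `Δ i j`, `i ≠ j`. -/
def collisionTimes {N d : ℕ} (l : ℝ → Config N d) : Set ℝ :=
  {t | l t ∈ collisionLocus N d}

/-- `l` is a polygonal curve, parametrized with constant velocity on each edge, whose vertices
are all attained at times in the locally finite set `S`. -/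
structure IsPolygonal {N d : ℕ} (l : ℝ → Config N d) (S : Set ℝ) : Prop where
  continuous : Continuous l
  locallyFinite : ∀ a b : ℝ, (S ∩ Set.Icc a b).Finite
  affine : ∀ a b : ℝ, a < b → Disjoint (Set.Ioo a b) S →
    ∃ v : Config N d, ∀ s ∈ Set.Icc a b, ∀ t ∈ Set.Icc a b, l t = l s + (t - s) • v

/-- `v` is the velocity of the piecewise linear curve `l` immediately before time `t`. -/
def IsVelocityBefore {N d : ℕ} (l : ℝ → Config N d) (t : ℝ) (v : Config N d) : Prop :=
  ∀ᶠ s in 𝓝[<] t, l s = l t + (s - t) • v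

/-- `v` is the velocity of the piecewise linear curve `l` immediately after time `t`. -/
def IsVelocityAfter {N d : ℕ} (l : ℝ → Config N d) (t : ℝ) (v : Config N d) : Prop :=
  ∀ᶠ s in 𝓝[>] t, l s = l t + (s - t) • v

/-- The reflection law for a velocity jump `vIn ↦ vOut` at the subspace `U`: conservation of the norm
and of the orthogonal projection onto `U`. -/
def ReflectionLaw {N d : ℕ} (m : Fin N → ℝ) (U : Submodule ℝ (Config N d))
    (vIn vOut : Config N d) : Prop :=
  massNorm m vIn = massNorm m vOut ∧ ∃ p, IsMassProj m U vIn p ∧ IsMassProj m U vOut p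

/-- Billiard trajectories of `N` point particles with masses `m` in Euclidean `d`-space. At a
time when the curve lies in several collision subspaces (for three particles: at a triple
collision) the reflection law is required for one of them, which may be any. -/
structure IsBilliardTrajectory {N d : ℕ} (m : Fin N → ℝ) (l : ℝ → Config N d) : Prop where
  /-- `l` is a polygonal curve all of whose vertices are collisions -/
  polygonal : ∃ S : Set ℝ, S ⊆ collisionTimes l ∧ IsPolygonal l S
  /-- collision points are discrete -/
  discrete : IsDiscrete (collisionTimes l)
  /-- no edge, nor any piece of an edge, lies within a collision subspace -/
  edge_not_mem : ∀ i j : Fin N, i ≠ j → ∀ a b : ℝ, a < b →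
    ∃ t ∈ Set.Icc a b, l t ∉ collisionSubspace i j
  /-- the velocity jumps at collisions obey the reflection law -/
  reflection : ∀ t ∈ collisionTimes l, ∃ i j : Fin N, i ≠ j ∧ l t ∈ collisionSubspace i j ∧
    ∀ vIn vOut : Config N d, IsVelocityBefore l t vIn → IsVelocityAfter l t vOut →
      ReflectionLaw m (collisionSubspace i j) vIn vOut

end PointBilliard

/-! Modulo translations, the equal-mass metric becomes `shapeInner`, up to a factor. At a collision
`q` the reflection law preserves both the pairing of the velocity with `q` and its shape norm. Hence
`shapeSq` along the trajectory does not feel the reflections: it is one quadratic polynomial in time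
(`shapeSq_eq_of_edge`).

Two collisions exclude triple ones (`shapeSq_pos`), so the polynomial is `E * ((t - t₀) ^ 2 + h ^
2)` with `E, h > 0`, as on a straight line missing the origin. The angle swept along an edge, seen
from the origin, is the increment of `arctan ((t - t₀) / h)`. Consecutive collisions lie in
different collision subspaces, whose vectors make angles of at least `π / 3` modulo translations
(`two_mul_shapeInner_le`). Each gap thus uses `π / 3` of a total angle that stays below `π`, so
there are at most two gaps. -/

open Polynomial in
/-- A function on `ℝ` that agrees locally with polynomials agrees globally with any one of them. -/
theorem eq_eval_of_locally_eq_eval {f : ℝ → ℝ}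
    (hf : ∀ t, ∃ p : ℝ[X], ∀ᶠ s in 𝓝 t, f s = p.eval s) {t : ℝ} {q : ℝ[X]}
    (hq : ∀ᶠ s in 𝓝 t, f s = q.eval s) (s : ℝ) : f s = q.eval s := by
  choose p hp using hf
  have unique : ∀ (a : ℝ) (p q : ℝ[X]), (∀ᶠ s in 𝓝 a, f s = p.eval s) →
      (∀ᶠ s in 𝓝 a, f s = q.eval s) → p = q := by
    intro a p q h₁ h₂
    apply Polynomial.eq_of_infinite_eval_eq
    refine infinite_of_mem_nhds a ?_
    filter_upwards [h₁, h₂] with s h₁ h₂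
    exact h₁.symm.trans h₂
  -- The polynomial germ is locally constant in its base point, hence constant since `ℝ` is
  -- connected.
  have hloc : IsLocallyConstant p := by
    rw [IsLocallyConstant.iff_eventually_eq]
    intro a
    filter_upwards [eventually_eventually_nhds.2 (hp a)] with s hs
    exact unique s _ _ (hp s) hs
  have h₁ : p s = p t := hloc.apply_eq_of_preconnectedSpace s t
  rw [(hp s).self_of_nhds, h₁, unique t _ _ (hp t) hq]

/-- If the directions of two points at heights `x < y` on the line at distance `h` from the origin
make an angle of cosine at most `1 / 2`, then this angle is at least `π / 3`. -/
theorem pi_div_three_le_arctan_sub {x y : ℝ} (hxy : x < y)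
    (h : 2 * (x * y + 1) ≤ √(1 + x ^ 2) * √(1 + y ^ 2)) :
    Real.pi / 3 ≤ Real.arctan y - Real.arctan x := by
  have hx : 0 < √(1 + x ^ 2) := by positivity
  have hy : 0 < √(1 + y ^ 2) := by positivity
  have hcos : Real.cos (Real.arctan y - Real.arctan x) ≤ 1 / 2 := by
    rw [Real.cos_sub, Real.cos_arctan, Real.cos_arctan, Real.sin_arctan, Real.sin_arctan]
    rw [show 1 / √(1 + y ^ 2) * (1 / √(1 + x ^ 2)) + y / √(1 + y ^ 2) * (x / √(1 + x ^ 2)) =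
      (x * y + 1) / (√(1 + x ^ 2) * √(1 + y ^ 2)) by field_simp; ring]
    rw [div_le_iff₀ (by positivity)]
    linarith
  by_contra! hlt
  have h₁ := Real.arctan_strictMono hxy
  have := Real.cos_lt_cos_of_nonneg_of_le_pi (sub_nonneg.2 h₁.le)
    (by linarith [Real.pi_pos] : Real.pi / 3 ≤ Real.pi) hlt
  rw [Real.cos_pi_div_three] at this
  linarith

/-- In a set meeting compact intervals in finite sets, an element below another one has a
successor. -/
theorem exists_next {T : Set ℝ} (hT : ∀ a b, (T ∩ Set.Icc a b).Finite) {u v : ℝ}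
    (hv : v ∈ T) (huv : u < v) :
    ∃ w ∈ T, u < w ∧ w ≤ v ∧ Disjoint (Set.Ioo u w) T := by
  obtain ⟨w, ⟨⟨hwT, huw⟩, hwv⟩, hmin⟩ := Set.exists_min_image (T ∩ Set.Ioi u ∩ Set.Iic v) id
    ((hT u v).subset fun x hx => ⟨hx.1.1, le_of_lt hx.1.2, hx.2⟩) ⟨v, ⟨hv, huv⟩, le_refl v⟩
  refine ⟨w, hwT, huw, hwv, Set.disjoint_left.2 fun x hx hxT => ?_⟩
  exact absurd (hmin x ⟨⟨hxT, hx.1⟩, hx.2.le.trans hwv⟩) (not_le.2 hx.2)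

/-- In a set meeting compact intervals in finite sets, an element above another one has a
predecessor. -/
theorem exists_previous {T : Set ℝ} (hT : ∀ a b, (T ∩ Set.Icc a b).Finite) {u v : ℝ}
    (hu : u ∈ T) (huv : u < v) :
    ∃ w ∈ T, w < v ∧ Disjoint (Set.Ioo w v) T := by
  obtain ⟨w, ⟨⟨hwT, hwv⟩, huw⟩, hmax⟩ := Set.exists_max_image (T ∩ Set.Iio v ∩ Set.Ici u) id
    ((hT u v).subset fun x hx => ⟨hx.1.1, hx.2, le_of_lt hx.1.2⟩) ⟨u, ⟨hu, huv⟩, le_refl u⟩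
  refine ⟨w, hwT, hwv, Set.disjoint_left.2 fun x hx hxT => ?_⟩
  exact absurd (hmax x ⟨⟨hxT, hx.2⟩, le_trans huw hx.1.le⟩) (not_le.2 hx.1)

/-! ### Shape metric and angles between collision subspaces -/

namespace PointBilliard

variable {d : ℕ}

/-- The translation-invariant part of the equal-mass inner product of three particles. -/
noncomputable def shapeInner (v w : Config 3 d) : ℝ :=
  inner ℝ (v 0 - v 1) (w 0 - w 1) + inner ℝ (v 1 - v 2) (w 1 - w 2) +
    inner ℝ (v 2 - v 0) (w 2 - w 0)

/-- The sum of the squares of the three mutual distances. -/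
noncomputable def shapeSq (v : Config 3 d) : ℝ := shapeInner v v

theorem shapeSq_eq (v : Config 3 d) :
    shapeSq v = ‖v 0 - v 1‖ ^ 2 + ‖v 1 - v 2‖ ^ 2 + ‖v 2 - v 0‖ ^ 2 := by
  simp only [shapeSq, shapeInner, real_inner_self_eq_norm_sq]

theorem shapeSq_nonneg (v : Config 3 d) : 0 ≤ shapeSq v := by
  rw [shapeSq_eq]; positivity

theorem eq_of_shapeSq_eq_zero {v : Config 3 d} (h : shapeSq v = 0) (i j : Fin 3) : v i = v j := by
  rw [shapeSq_eq] at h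
  have h₀ : v 0 = v 1 := by
    rw [← sub_eq_zero, ← norm_eq_zero, ← sq_eq_zero_iff]
    nlinarith [sq_nonneg ‖v 0 - v 1‖, sq_nonneg ‖v 1 - v 2‖, sq_nonneg ‖v 2 - v 0‖]
  have h₁ : v 1 = v 2 := by
    rw [← sub_eq_zero, ← norm_eq_zero, ← sq_eq_zero_iff]
    nlinarith [sq_nonneg ‖v 0 - v 1‖, sq_nonneg ‖v 1 - v 2‖, sq_nonneg ‖v 2 - v 0‖]
  have h₂ : ∀ i, v i = v 0 := by
    intro i
    fin_cases i
    exacts [rfl, h₀.symm, (h₀.trans h₁).symm]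
  rw [h₂ i, h₂ j]

theorem shapeSq_add_smul (q v : Config 3 d) (c : ℝ) :
    shapeSq (q + c • v) = shapeSq q + 2 * c * shapeInner q v + c ^ 2 * shapeSq v := by
  simp only [shapeSq, shapeInner, Pi.add_apply, Pi.smul_apply, inner_sub_left, inner_sub_right,
    inner_add_left, inner_add_right, real_inner_smul_left, real_inner_smul_right]
  rw [real_inner_comm (q 0) (v 0), real_inner_comm (q 0) (v 1), real_inner_comm (q 0) (v 2),
    real_inner_comm (q 1) (v 0), real_inner_comm (q 1) (v 1), real_inner_comm (q 1) (v 2),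
    real_inner_comm (q 2) (v 0), real_inner_comm (q 2) (v 1), real_inner_comm (q 2) (v 2)]
  ring

/-- The collision subspaces, indexed by the particle that does not collide. -/
theorem exists_opposite {i j : Fin 3} (hij : i ≠ j) {q : Config 3 d}
    (hq : q ∈ collisionSubspace i j) : ∃ k : Fin 3, q (k + 1) = q (k + 2) := by
  have hq : q i = q j := hq
  have opposite : ∀ i j : Fin 3, i ≠ j →
      ∃ k : Fin 3, (i = k + 1 ∧ j = k + 2) ∨ (i = k + 2 ∧ j = k + 1) := by
    decide
  obtain ⟨k, ⟨rfl, rfl⟩ | ⟨rfl, rfl⟩⟩ := opposite i j hij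
  exacts [⟨k, hq⟩, ⟨k, hq.symm⟩]

theorem add_one_ne_add_two (k : Fin 3) : k + 1 ≠ k + 2 := by
  revert k; decide

theorem mem_collisionLocus_iff {q : Config 3 d} :
    q ∈ collisionLocus 3 d ↔ ∃ k : Fin 3, q (k + 1) = q (k + 2) :=
  ⟨fun ⟨_, _, hij, hq⟩ => exists_opposite hij hq, fun ⟨k, hk⟩ =>
    ⟨k + 1, k + 2, add_one_ne_add_two k, hk⟩⟩

/-- Two different collision subspaces make an angle of at least `π / 3`. -/
theorem two_mul_shapeInner_le {k l : Fin 3} (hkl : k ≠ l) {q q' : Config 3 d}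
    (hq : q (k + 1) = q (k + 2)) (hq' : q' (l + 1) = q' (l + 2)) :
    2 * shapeInner q q' ≤ √(shapeSq q) * √(shapeSq q') := by
  -- On a collision subspace one difference vanishes and the other two are opposite. Only the pair
  -- `{k, l}` has nonvanishing differences `a`, `b` on both sides in general, so Cauchy–Schwarz for
  -- `a`, `b` yields the factor 2.
  have key : ∀ (a b : EuclideanSpace ℝ (Fin d)), shapeInner q q' = inner ℝ a b →
      shapeSq q = 2 * ‖a‖ ^ 2 → shapeSq q' = 2 * ‖b‖ ^ 2 →
      2 * shapeInner q q' ≤ √(shapeSq q) * √(shapeSq q') := by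
    intro a b h₁ h₂ h₃
    rw [← Real.sqrt_mul (shapeSq_nonneg _), h₁, h₂, h₃,
      show 2 * ‖a‖ ^ 2 * (2 * ‖b‖ ^ 2) = (2 * (‖a‖ * ‖b‖)) ^ 2 by ring,
      Real.sqrt_sq (by positivity)]
    linarith [real_inner_le_norm a b]
  fin_cases k <;> fin_cases l <;> first | exact absurd rfl hkl | skip
  · have h : q 1 = q 2 := hq
    have h' : q' 2 = q' 0 := hq'
    refine key (q 0 - q 1) (q' 0 - q' 1) ?_ ?_ ?_ <;>
      simp [shapeInner, shapeSq_eq, h, h', norm_sub_rev (q 2) (q 0), norm_sub_rev (q' 1) (q' 0)] <;>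
      ring
  · have h : q 1 = q 2 := hq
    have h' : q' 0 = q' 1 := hq'
    refine key (q 2 - q 0) (q' 2 - q' 0) ?_ ?_ ?_ <;>
      simp [shapeInner, shapeSq_eq, h, h', norm_sub_rev (q 2) (q 0), norm_sub_rev (q' 2) (q' 1)] <;>
      ring
  · have h : q 2 = q 0 := hq
    have h' : q' 1 = q' 2 := hq'
    refine key (q 0 - q 1) (q' 0 - q' 1) ?_ ?_ ?_ <;>
      simp [shapeInner, shapeSq_eq, h, h', norm_sub_rev (q 1) (q 0), norm_sub_rev (q' 2) (q' 0)] <;>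
      ring
  · have h : q 2 = q 0 := hq
    have h' : q' 0 = q' 1 := hq'
    refine key (q 1 - q 2) (q' 1 - q' 2) ?_ ?_ ?_ <;>
      simp [shapeInner, shapeSq_eq, h, h', norm_sub_rev (q 1) (q 0), norm_sub_rev (q' 2) (q' 1)] <;>
      ring
  · have h : q 0 = q 1 := hq
    have h' : q' 1 = q' 2 := hq'
    refine key (q 2 - q 0) (q' 2 - q' 0) ?_ ?_ ?_ <;>
      simp [shapeInner, shapeSq_eq, h, h', norm_sub_rev (q 2) (q 1), norm_sub_rev (q' 2) (q' 0)] <;>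
      ring
  · have h : q 0 = q 1 := hq
    have h' : q' 2 = q' 0 := hq'
    refine key (q 1 - q 2) (q' 1 - q' 2) ?_ ?_ ?_ <;>
      simp [shapeInner, shapeSq_eq, h, h', norm_sub_rev (q 2) (q 1), norm_sub_rev (q' 1) (q' 0)] <;>
      ring

/-! ### Quantities conserved by the reflection law -/

/-- The reflection law preserves the inner product of the velocity with vectors of the collision
subspace. -/
theorem ReflectionLaw.sum_inner_sub_eq_zero {N : ℕ} {M : ℝ} (hM : 0 < M)
    {U : Submodule ℝ (Config N d)} {v w : Config N d}
    (h : ReflectionLaw (fun _ => M) U v w) {u : Config N d} (hu : u ∈ U) :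
    ∑ i, inner ℝ (v i - w i) (u i) = 0 := by
  obtain ⟨-, p, hv, hw⟩ := h
  have h₁ := hv.2 u hu
  have h₂ := hw.2 u hu
  rw [massInner, ← Finset.mul_sum, mul_eq_zero, or_iff_right hM.ne'] at h₁ h₂
  rw [← sub_eq_zero_of_eq (h₁.trans h₂.symm), ← Finset.sum_sub_distrib]
  refine Finset.sum_congr rfl fun i _ => ?_
  rw [← inner_sub_left]
  simp

theorem ReflectionLaw.sum_norm_sq_eq {N : ℕ} {M : ℝ} (hM : 0 < M)
    {U : Submodule ℝ (Config N d)} {v w : Config N d}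
    (h : ReflectionLaw (fun _ => M) U v w) : ∑ i, ‖v i‖ ^ 2 = ∑ i, ‖w i‖ ^ 2 := by
  have h₁ := h.1
  have hnn : ∀ v : Config N d, massInner (fun _ => M) v v = M * ∑ i, ‖v i‖ ^ 2 := by
    intro v
    simp [massInner, Finset.mul_sum]
  rw [massNorm, massNorm, Real.sqrt_inj, hnn, hnn] at h₁
  · exact mul_left_cancel₀ hM.ne' h₁
  · rw [hnn]; positivity
  · rw [hnn]; positivity

theorem ReflectionLaw.shapeInner_eq {M : ℝ} (hM : 0 < M) {i j : Fin 3} {v w : Config 3 d}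
    (h : ReflectionLaw (fun _ => M) (collisionSubspace i j) v w) {q : Config 3 d}
    (hq : q ∈ collisionSubspace i j) : shapeInner q v = shapeInner q w := by
  -- Three times the configuration centred at its centre of mass: it stays in the collision
  -- subspace, and its Euclidean pairing with `v` is `shapeInner q v`.
  have hu : (fun a => (3 : ℝ) • q a - (q 0 + q 1 + q 2)) ∈
      (collisionSubspace i j : Submodule ℝ (Config 3 d)) := by
    have hq : q i = q j := hq
    change (3 : ℝ) • q i - (q 0 + q 1 + q 2) = (3 : ℝ) • q j - (q 0 + q 1 + q 2)
    rw [hq]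
  have key := h.sum_inner_sub_eq_zero hM hu
  rw [← sub_eq_zero, ← key]
  simp only [Fin.sum_univ_three, shapeInner, inner_sub_left, inner_sub_right, inner_add_right,
    real_inner_smul_right, real_inner_comm (q _) (v _), real_inner_comm (q _) (w _)]
  ring

/-- Translations lie in every collision subspace, so total momentum is conserved; the shape norm is
a combination of kinetic energy and squared momentum. -/
theorem ReflectionLaw.shapeSq_eq {M : ℝ} (hM : 0 < M) {i j : Fin 3} {v w : Config 3 d}
    (h : ReflectionLaw (fun _ => M) (collisionSubspace i j) v w) : shapeSq v = shapeSq w := by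
  have hsum : v 0 + v 1 + v 2 = w 0 + w 1 + w 2 := by
    rw [← sub_eq_zero]
    refine ext_inner_right ℝ fun e => ?_
    have hu : (fun _ => e) ∈ (collisionSubspace i j : Submodule ℝ (Config 3 d)) := rfl
    have := h.sum_inner_sub_eq_zero hM hu
    rw [← sum_inner, Fin.sum_univ_three] at this
    rw [inner_zero_left, ← this]
    congr 1
    abel
  have huyghens : ∀ v : Config 3 d,
      shapeSq v = 3 * ∑ i, ‖v i‖ ^ 2 - ‖v 0 + v 1 + v 2‖ ^ 2 := by
    intro v
    simp only [shapeSq, shapeInner, Fin.sum_univ_three, ← real_inner_self_eq_norm_sq,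
      inner_sub_left, inner_sub_right, inner_add_left, inner_add_right]
    rw [real_inner_comm (v 0) (v 1), real_inner_comm (v 0) (v 2), real_inner_comm (v 1) (v 2)]
    ring
  rw [huyghens, huyghens, hsum, h.sum_norm_sq_eq hM]

theorem IsPolygonal.exists_pos_disjoint {N : ℕ} {l : ℝ → Config N d} {S : Set ℝ}
    (hl : IsPolygonal l S) (t : ℝ) : ∃ ε > 0, ∀ s ∈ S, |s - t| < ε → s = t := by
  have hfin : ((S ∩ Set.Icc (t - 1) (t + 1)) \ {t}).Finite :=
    (hl.locallyFinite (t - 1) (t + 1)).subset Set.sdiff_subset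
  have hmem : ((S ∩ Set.Icc (t - 1) (t + 1)) \ {t})ᶜ ∈ 𝓝 t :=
    hfin.isClosed.isOpen_compl.mem_nhds (by simp)
  obtain ⟨ε, hε, hball⟩ := Metric.mem_nhds_iff.1 hmem
  refine ⟨min ε 1, lt_min hε one_pos, fun s hs hst => ?_⟩
  by_contra hne
  have h₁ := hball (show s ∈ Metric.ball t ε from hst.trans_le (min_le_left _ _))
  have h₂ := abs_lt.1 (hst.trans_le (min_le_right _ _))
  exact h₁ ⟨⟨hs, by linarith [h₂.1], by linarith [h₂.2]⟩, hne⟩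

open Polynomial in
/-- The quadratic polynomial `s ↦ shapeSq (q + (s - t) • v)`. -/
noncomputable def shapePoly (q v : Config 3 d) (t : ℝ) : ℝ[X] :=
  C (shapeSq q) + C (2 * shapeInner q v) * (X - C t) + C (shapeSq v) * (X - C t) ^ 2

theorem eval_shapePoly (q v : Config 3 d) (t s : ℝ) :
    (shapePoly q v t).eval s = shapeSq (q + (s - t) • v) := by
  rw [shapeSq_add_smul]
  simp [shapePoly]
  ring

/-! ### Evolution of the shape along a trajectory -/

namespace IsBilliardTrajectory

variable {M : ℝ} {l : ℝ → Config 3 d}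

/-- At a collision, the quadratics of the incoming and outgoing edges have the same coefficients by
the two conservation laws. -/
theorem locally_shapeSq_eq (hM : 0 < M) (hl : IsBilliardTrajectory (fun _ => M) l) (t : ℝ) :
    ∃ p : Polynomial ℝ, ∀ᶠ s in 𝓝 t, shapeSq (l s) = p.eval s := by
  obtain ⟨S, hST, hS⟩ := hl.polygonal
  obtain ⟨ε, hε, hεS⟩ := hS.exists_pos_disjoint t
  by_cases ht : t ∈ collisionTimes l
  · obtain ⟨v, hv⟩ := hS.affine (t - ε) t (by linarith) (Set.disjoint_left.2 fun s hs hsS => by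
      have := hεS s hsS (abs_lt.2 ⟨by linarith [hs.1], by linarith [hs.2]⟩)
      exact hs.2.ne this)
    obtain ⟨w, hw⟩ := hS.affine t (t + ε) (by linarith) (Set.disjoint_left.2 fun s hs hsS => by
      have := hεS s hsS (abs_lt.2 ⟨by linarith [hs.1], by linarith [hs.2]⟩)
      exact hs.1.ne' this)
    obtain ⟨i, j, -, hq, hrefl⟩ := hl.reflection t ht
    have hbefore : IsVelocityBefore l t v := by
      filter_upwards [Ioo_mem_nhdsLT (show t - ε < t by linarith)] with s hs
      exact hv t ⟨by linarith, le_rfl⟩ s ⟨hs.1.le, hs.2.le⟩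
    have hafter : IsVelocityAfter l t w := by
      filter_upwards [Ioo_mem_nhdsGT (show t < t + ε by linarith)] with s hs
      exact hw t ⟨le_rfl, by linarith⟩ s ⟨hs.1.le, hs.2.le⟩
    have law := hrefl v w hbefore hafter
    refine ⟨shapePoly (l t) v t, ?_⟩
    filter_upwards [Ioo_mem_nhds (show t - ε < t by linarith) (show t < t + ε by linarith)]
      with s hs
    rw [eval_shapePoly]
    rcases le_total s t with hst | hst
    · rw [hv t ⟨by linarith, le_rfl⟩ s ⟨hs.1.le, hst⟩]
    · rw [hw t ⟨le_rfl, by linarith⟩ s ⟨hst, hs.2.le⟩, shapeSq_add_smul, shapeSq_add_smul,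
        law.shapeInner_eq hM hq, law.shapeSq_eq hM]
  · obtain ⟨v, hv⟩ := hS.affine (t - ε) (t + ε) (by linarith)
      (Set.disjoint_left.2 fun s hs hsS => by
        have := hεS s hsS (abs_lt.2 ⟨by linarith [hs.1], by linarith [hs.2]⟩)
        exact ht (hST (this ▸ hsS)))
    refine ⟨shapePoly (l t) v t, ?_⟩
    filter_upwards [Ioo_mem_nhds (show t - ε < t by linarith) (show t < t + ε by linarith)]
      with s hs
    rw [eval_shapePoly, hv t ⟨by linarith, by linarith⟩ s ⟨hs.1.le, hs.2.le⟩]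

/-- The sum of the squared mutual distances is a single quadratic polynomial in time, given by any
edge. -/
theorem shapeSq_eq_of_edge (hM : 0 < M) (hl : IsBilliardTrajectory (fun _ => M) l) {a b : ℝ}
    (hab : a < b) {v : Config 3 d} (hv : ∀ t ∈ Set.Icc a b, l t = l a + (t - a) • v) (s : ℝ) :
    shapeSq (l s) =
      shapeSq (l a) + 2 * (s - a) * shapeInner (l a) v + (s - a) ^ 2 * shapeSq v := by
  rw [← shapeSq_add_smul, ← eval_shapePoly]
  refine eq_eval_of_locally_eq_eval (f := fun s => shapeSq (l s)) (t := (a + b) / 2)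
    (hl.locally_shapeSq_eq hM) ?_ s
  filter_upwards [Ioo_mem_nhds (show a < (a + b) / 2 by linarith)
    (show (a + b) / 2 < b by linarith)] with s hs
  rw [eval_shapePoly, hv s ⟨hs.1.le, hs.2.le⟩]

/-- Discreteness alone would allow accumulation at a time outside the set; continuity makes the set
closed and rules this out. -/
theorem finite_collisionTimes_inter {m : Fin 3 → ℝ} (hl : IsBilliardTrajectory m l) (a b : ℝ) :
    (collisionTimes l ∩ Set.Icc a b).Finite := by
  obtain ⟨S, -, hS⟩ := hl.polygonal
  have hcont : ∀ i, Continuous fun t => l t i := fun i => (continuous_apply i).comp hS.continuous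
  have hclosed : IsClosed (collisionTimes l) := by
    have : collisionTimes l = ⋃ k : Fin 3, {t | l t (k + 1) = l t (k + 2)} := by
      ext t
      simp only [collisionTimes, Set.mem_ofPred_eq, mem_collisionLocus_iff, Set.mem_iUnion]
    rw [this]
    exact isClosed_iUnion_of_finite fun k => isClosed_eq (hcont _) (hcont _)
  exact (isCompact_Icc.inter_left hclosed).finite (hl.discrete.mono Set.inter_subset_left)

/-- The shape of a billiard trajectory on the edge between two consecutive collisions. -/
theorem edge_between_collisions (hM : 0 < M) (hl : IsBilliardTrajectory (fun _ => M) l) {u w : ℝ}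
    (hu : u ∈ collisionTimes l) (hw : w ∈ collisionTimes l) (huw : u < w)
    (hdisj : Disjoint (Set.Ioo u w) (collisionTimes l)) :
    0 < shapeSq (l u) ∧ 0 < shapeSq (l w) ∧ ∃ E β : ℝ, 0 < E ∧
      (∀ s, shapeSq (l s) = shapeSq (l u) + β * (s - u) + E * (s - u) ^ 2) ∧
      shapeSq (l u) + shapeSq (l w) - E * (w - u) ^ 2 ≤
        √(shapeSq (l u)) * √(shapeSq (l w)) := by
  obtain ⟨S, hST, hS⟩ := hl.polygonal
  obtain ⟨v, hv'⟩ := hS.affine u w huw (hdisj.mono_right hST)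
  have hv : ∀ t ∈ Set.Icc u w, l t = l u + (t - u) • v := hv' u ⟨le_rfl, huw.le⟩
  have hlw := hv w ⟨huw.le, le_rfl⟩
  obtain ⟨k, hk⟩ := mem_collisionLocus_iff.1 hu
  obtain ⟨k', hk'⟩ := mem_collisionLocus_iff.1 hw
  have hne : ∀ k : Fin 3, l u (k + 1) = l u (k + 2) → v (k + 1) ≠ v (k + 2) := by
    intro k hk hvk
    obtain ⟨t, ht, hnot⟩ := hl.edge_not_mem _ _ (add_one_ne_add_two k) u w huw
    apply hnot
    change l t (k + 1) = l t (k + 2)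
    rw [hv t ht]
    simp [hk, hvk]
  -- A pair colliding at both ends would collide along the whole edge. A triple collision at one end
  -- is excluded too, since it would include the pair colliding at the other end.
  have hne' : ∀ k : Fin 3, l u (k + 1) = l u (k + 2) → l w (k + 1) ≠ l w (k + 2) := by
    intro k hk hwk
    apply hne k hk
    rw [hlw] at hwk
    simpa [hk, sub_ne_zero.2 huw.ne'] using hwk
  have hkk' : k ≠ k' := by
    rintro rfl
    exact hne' k hk hk'
  refine ⟨(shapeSq_nonneg _).lt_of_ne fun h => ?_, (shapeSq_nonneg _).lt_of_ne fun h => ?_,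
    shapeSq v, 2 * shapeInner (l u) v, (shapeSq_nonneg _).lt_of_ne fun h => ?_, fun s => ?_, ?_⟩
  · exact hne' k' (eq_of_shapeSq_eq_zero h.symm _ _) hk'
  · exact hne' k hk (eq_of_shapeSq_eq_zero h.symm _ _)
  · exact hne k hk (eq_of_shapeSq_eq_zero h.symm _ _)
  · rw [hl.shapeSq_eq_of_edge hM huw hv s]
    ring
  -- Polarization: the left side is `2 * shapeInner (l u) (l w)`.
  · refine le_trans (le_of_eq ?_) (two_mul_shapeInner_le hkk' hk hk')
    have h₁ : shapeInner (l u) (l w) = shapeSq (l u) + (w - u) * shapeInner (l u) v := by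
      rw [hlw]
      simp only [shapeSq, shapeInner, Pi.add_apply, Pi.smul_apply, inner_sub_right,
        inner_add_right, real_inner_smul_right]
      ring
    rw [h₁, hl.shapeSq_eq_of_edge hM huw hv w]
    ring

/-- If there are two collisions, no triple collision occurs. -/
theorem shapeSq_pos (hM : 0 < M) (hl : IsBilliardTrajectory (fun _ => M) l) {u v : ℝ}
    (hu : u ∈ collisionTimes l) (hv : v ∈ collisionTimes l) (huv : u < v) (s : ℝ) :
    0 < shapeSq (l s) := by
  by_cases hs : s ∈ collisionTimes l
  -- Every collision has a neighbouring one, after it or before it, hence is an end of an edge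
  -- between collisions.
  · rcases lt_or_ge s v with hsv | hvs
    · obtain ⟨w, hw, hsw, -, hdisj⟩ := exists_next hl.finite_collisionTimes_inter hv hsv
      exact (hl.edge_between_collisions hM hs hw hsw hdisj).1
    · obtain ⟨w, hw, hws, hdisj⟩ :=
        exists_previous hl.finite_collisionTimes_inter hu (huv.trans_le hvs)
      exact (hl.edge_between_collisions hM hw hs hws hdisj).2.1
  · refine (shapeSq_nonneg _).lt_of_ne fun h => hs ?_
    exact mem_collisionLocus_iff.2 ⟨0, eq_of_shapeSq_eq_zero h.symm _ _⟩

/-- If there are two collisions, then in a suitable affine time the angular variable increases by at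
least `π / 3` between any two collisions. -/
theorem exists_pi_div_three_le_arctan_sub (hM : 0 < M)
    (hl : IsBilliardTrajectory (fun _ => M) l) {u v : ℝ}
    (hu : u ∈ collisionTimes l) (hv : v ∈ collisionTimes l) (huv : u < v) :
    ∃ t₀ h : ℝ, 0 < h ∧ ∀ a ∈ collisionTimes l, ∀ b ∈ collisionTimes l, a < b →
      Real.pi / 3 ≤ Real.arctan ((b - t₀) / h) - Real.arctan ((a - t₀) / h) := by
  obtain ⟨w, hw, huw, -, hdisj⟩ := exists_next hl.finite_collisionTimes_inter hv huv
  obtain ⟨-, -, E, β, hE, hI, -⟩ := hl.edge_between_collisions hM hu hw huw hdisj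
  -- The time at which the quadratic is minimal.
  set t₀ := u - β / (2 * E) with ht₀
  have hI₀ : ∀ s, shapeSq (l s) = shapeSq (l t₀) + E * (s - t₀) ^ 2 := by
    intro s
    rw [hI s, hI t₀, ht₀]
    field_simp
    ring
  have hpos := hl.shapeSq_pos hM hu hv huv t₀
  set h := √(shapeSq (l t₀) / E) with hh
  have hhpos : 0 < h := Real.sqrt_pos.2 (div_pos hpos hE)
  have hsq : h ^ 2 = shapeSq (l t₀) / E := Real.sq_sqrt (div_pos hpos hE).le
  have hI₁ : ∀ s, shapeSq (l s) = E * h ^ 2 * (1 + ((s - t₀) / h) ^ 2) := by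
    intro s
    have h₁ : shapeSq (l t₀) = E * h ^ 2 := by rw [hsq]; field_simp
    rw [hI₀ s, h₁]
    field_simp
  refine ⟨t₀, h, hhpos, fun a ha b hb hab => ?_⟩
  obtain ⟨c, hc, hac, hcb, hdisj'⟩ := exists_next hl.finite_collisionTimes_inter hb hab
  obtain ⟨-, -, E', β', -, hI', hangle⟩ := hl.edge_between_collisions hM ha hc hac hdisj'
  -- Both are leading coefficients of the same quadratic, compared by a second difference at `a`.
  have hEE' : E' = E := by
    have h₁ := (hI' (a + 1)).symm.trans (hI₀ (a + 1))
    have h₂ := (hI' (a - 1)).symm.trans (hI₀ (a - 1))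
    have h₃ := hI₀ a
    ring_nf at h₁ h₂ h₃
    linarith
  have hstep : Real.pi / 3 ≤ Real.arctan ((c - t₀) / h) - Real.arctan ((a - t₀) / h) := by
    refine pi_div_three_le_arctan_sub (by gcongr) ?_
    have hEh : 0 < E * h ^ 2 := by positivity
    rw [hEE', hI₁ a, hI₁ c, Real.sqrt_mul hEh.le, Real.sqrt_mul hEh.le,
      mul_mul_mul_comm, Real.mul_self_sqrt hEh.le] at hangle
    refine le_of_mul_le_mul_left (le_trans (le_of_eq ?_) hangle) hEh
    field_simp
    ring
  have hmono : Real.arctan ((c - t₀) / h) ≤ Real.arctan ((b - t₀) / h) :=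
    Real.arctan_strictMono.monotone (by gcongr)
  linarith

end IsBilliardTrajectory

end PointBilliard

theorem theorem3 (M : ℝ) (hM : 0 < M) (l : ℝ → PointBilliard.Config 3 2)
    (hl : PointBilliard.IsBilliardTrajectory (fun _ : Fin 3 => M) l) :
    (PointBilliard.collisionTimes l).encard ≤ 3 := by
  by_contra! hlt
  -- The set of collisions is not yet known to be finite; four of them, not necessarily consecutive,
  -- suffice.
  obtain ⟨T, hTl, hT⟩ := Set.exists_subset_encard_eq (Order.add_one_le_of_lt hlt)
  have hfin : T.Finite := Set.finite_of_encard_eq_coe (k := 4) (by rw [hT]; rfl)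
  lift T to Finset ℝ using hfin
  have hcard : T.card = 4 := by
    rw [Set.encard_coe_eq_coe_finsetCard] at hT
    exact_mod_cast hT
  have hmem : ∀ i, T.orderEmbOfFin hcard i ∈ PointBilliard.collisionTimes l :=
    fun i => hTl (T.orderEmbOfFin_mem hcard i)
  have hlt' : ∀ i j : Fin 4, i < j → T.orderEmbOfFin hcard i < T.orderEmbOfFin hcard j :=
    fun i j hij => (T.orderEmbOfFin hcard).strictMono hij
  obtain ⟨t₀, h, -, hgap⟩ := hl.exists_pi_div_three_le_arctan_sub hM (hmem 0) (hmem 1)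
    (hlt' 0 1 (by decide))
  have h₁ := hgap _ (hmem 0) _ (hmem 1) (hlt' 0 1 (by decide))
  have h₂ := hgap _ (hmem 1) _ (hmem 2) (hlt' 1 2 (by decide))
  have h₃ := hgap _ (hmem 2) _ (hmem 3) (hlt' 2 3 (by decide))
  -- The three gaps add up to at least `π`, but `arctan` takes values in an open interval of length
  -- `π`.
  have h₄ := Real.neg_pi_div_two_lt_arctan ((T.orderEmbOfFin hcard 0 - t₀) / h)
  have h₅ := Real.arctan_lt_pi_div_two ((T.orderEmbOfFin hcard 3 - t₀) / h)
  linarith
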